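/- **Setting.** An instance $\mathcal I=(\mathcal A,\mathcal B,v_1,v_2)$ consists of finite action sets $\mathcal A$ (leader, player 1) and $\mathcal B$ (follower, player 2) and mean rewards $v_1,v_2:\mathcal A\times\mathcal B\to[0,1]$. The best response $b^*(a)$ maximizes $v_2(a,\cdot)$, ties being broken towards the lowest $v_1(a,\cdot)$. A Stackelberg equilibrium is a pair $(a^*,b^*)$ with $a^*\in\arg\max_a v_1(a,b^*(a))$ and $b^*=b^*(a^*)$; the Stackelberg benchmarks are $\beta_i=v_i(a^*,b^*)$, $i=1,2$. The game is repeated for $T$ rounds. In round $t$ the leader draws $a_t$ from a distribution given by $\mathtt{ALG}_1$ as a function of the leader's history, the follower sees $a_t$ and draws $b_t$ from a distribution given by $\mathtt{ALG}_2$ as a function of $a_t$ and the follower's history, and then the players receive independent rewards $r_{1,t}\sim\mathcal N(v_1(a_t,b_t),1)$ and $r_{2,t}\sim\mathcal N(v_2(a_t,b_t),1)$, which are independent across rounds given the actions. The follower's history is $(a_s,b_s,r_{2,s})_{s<t}$. The leader's history is $(a_s,r_{1,s})_{s<t}$ in a strongly decentralized game and $(a_s,b_s,r_{1,s})_{s<t}$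 in a weakly decentralized game. The regret of player $i$ is $R_i(T;\mathcal I)=\beta_iT-\sum_{t=1}^T\mathbb E[r_{i,t}]$. **Theorem.** There is an absolute constant $c>0$ such that the following holds both for strongly and for weakly decentralized Stackelberg games. Let $|\mathcal A|=|\mathcal B|=2$. For every horizon $T$ and every pair of algorithms $\mathtt{ALG}_1$, $\mathtt{ALG}_2$ (which may depend on $T$), there is an instance $\mathcal I^*=(\mathcal A,\mathcal B,v_1,v_2)$ such that $$\max\bigl(R_1(T;\mathcal I^*),R_2(T;\mathcal I^*)\bigr)\ \ge\ c\,T,$$ where the regrets are taken against the Stackelberg benchmarks; if $\mathcal I^*$ has several Stackelberg equilibria, this holds for each of them. -/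

import Mathlib

open MeasureTheory ProbabilityTheory

namespace StackelbergGame

/-- An instance of the static Stackelberg game: mean rewards in `[0, 1]` of the leader (`v₁`) and
of the follower (`v₂`) for each pair of actions. -/
structure Instance (A B : Type*) where
  v₁ : A → B → ℝ
  v₂ : A → B → ℝ
  v₁_mem : ∀ a b, v₁ a b ∈ Set.Icc (0 : ℝ) 1
  v₂_mem : ∀ a b, v₂ a b ∈ Set.Icc (0 : ℝ) 1

namespace Instance

variable {A B : Type*} (I : Instance A B)

/-- `b` is the follower's best response to `a`; ties in the follower's utility are broken towards
the lowest leader utility. -/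
def IsBestResponse (a : A) (b : B) : Prop :=
  (∀ b', I.v₂ a b' ≤ I.v₂ a b) ∧ ∀ b', I.v₂ a b' = I.v₂ a b → I.v₁ a b ≤ I.v₁ a b'

/-- `p = (a*, b*)` is a Stackelberg equilibrium in pure strategies: `b*` is the best response to
`a*`, and no other leader action gives the leader more when the follower best-responds. -/
def IsStackelbergEquilibrium (p : A × B) : Prop :=
  I.IsBestResponse p.1 p.2 ∧
    ∀ a b, I.IsBestResponse a b → I.v₁ a b ≤ I.v₁ p.1 p.2

end Instance

section Game

variable {A B : Type*} [MeasurableSpace A] [MeasurableSpace B]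

/-- What happens in one round: the actions `(a, b)` and the rewards `(r₁, r₂)`. -/
abbrev Round (A B : Type*) : Type _ := (A × B) × ℝ × ℝ

/-- A leader algorithm in a strongly decentralized game: for each number `n` of past rounds, a
distribution over `A` given the past leader actions and leader rewards. -/
structure StrongLeaderAlgorithm (A : Type*) [MeasurableSpace A] where
  policy : (n : ℕ) → Kernel (Fin n → A × ℝ) A
  markov : ∀ n, IsMarkovKernel (policy n)

/-- A leader algorithm in a weakly decentralized game: for each number `n` of past rounds, a
distribution over `A` given the past actions of both players and the past leader rewards. -/
structure WeakLeaderAlgorithm (A B : Type*) [MeasurableSpace A] [MeasurableSpace B] where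
  policy : (n : ℕ) → Kernel (Fin n → (A × B) × ℝ) A
  markov : ∀ n, IsMarkovKernel (policy n)

/-- A follower algorithm: for each number `n` of past rounds, a distribution over `B` given the
leader's current action, the past actions of both players and the past follower rewards. -/
structure FollowerAlgorithm (A B : Type*) [MeasurableSpace A] [MeasurableSpace B] where
  policy : (n : ℕ) → Kernel (A × (Fin n → (A × B) × ℝ)) B
  markov : ∀ n, IsMarkovKernel (policy n)

/-- The leader's choice as a kernel on full histories: only the leader's own past actions and
rewards are used. -/
noncomputable def StrongLeaderAlgorithm.onHistory (B : Type*) [MeasurableSpace B]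
    (L : StrongLeaderAlgorithm A) (n : ℕ) : Kernel (Fin n → Round A B) A :=
  (L.policy n).comap (fun h t ↦ ((h t).1.1, (h t).2.1)) (by fun_prop)

/-- The leader's choice as a kernel on full histories: only the past actions and the past leader
rewards are used. -/
noncomputable def WeakLeaderAlgorithm.onHistory
    (L : WeakLeaderAlgorithm A B) (n : ℕ) : Kernel (Fin n → Round A B) A :=
  (L.policy n).comap (fun h t ↦ ((h t).1, (h t).2.1)) (by fun_prop)

/-- The follower's choice as a kernel on full histories and the leader's current action: only the
past actions and the past follower rewards are used. -/
noncomputable def FollowerAlgorithm.onHistory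
    (F : FollowerAlgorithm A B) (n : ℕ) : Kernel ((Fin n → Round A B) × A) B :=
  (F.policy n).comap (fun q ↦ (q.2, fun t ↦ ((q.1 t).1, (q.1 t).2.2))) (by fun_prop)

instance (L : StrongLeaderAlgorithm A) (n : ℕ) : IsMarkovKernel (L.onHistory B n) := by
  have := L.markov n
  unfold StrongLeaderAlgorithm.onHistory
  infer_instance

instance (L : WeakLeaderAlgorithm A B) (n : ℕ) : IsMarkovKernel (L.onHistory n) := by
  have := L.markov n
  unfold WeakLeaderAlgorithm.onHistory
  infer_instance

instance (F : FollowerAlgorithm A B) (n : ℕ) : IsMarkovKernel (F.onHistory n) := by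
  have := F.markov n
  unfold FollowerAlgorithm.onHistory
  infer_instance

variable [Finite A] [Finite B] [DiscreteMeasurableSpace A] [DiscreteMeasurableSpace B]

/-- Given the actions `(a, b)`, the rewards are independent, `N(v₁ a b, 1)` for the leader and
`N(v₂ a b, 1)` for the follower. -/
noncomputable def Instance.reward (I : Instance A B) : Kernel (A × B) (ℝ × ℝ) :=
  Kernel.ofFunOfCountable
    fun p ↦ (gaussianReal (I.v₁ p.1 p.2) 1).prod (gaussianReal (I.v₂ p.1 p.2) 1)

instance (I : Instance A B) : IsMarkovKernel I.reward :=
  ⟨fun p ↦ by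
    change IsProbabilityMeasure
      ((gaussianReal (I.v₁ p.1 p.2) 1).prod (gaussianReal (I.v₂ p.1 p.2) 1))
    infer_instance⟩

/-- The conditional law of the next round given the full history of the first `n` rounds: the
leader plays, then the follower plays having seen the leader's action, then the rewards are
drawn. -/
noncomputable def step (I : Instance A B) (L : (n : ℕ) → Kernel (Fin n → Round A B) A)
    (F : FollowerAlgorithm A B) (n : ℕ) : Kernel (Fin n → Round A B) (Round A B) :=
  (L n ⊗ₖ F.onHistory n) ⊗ₖ I.reward.comap Prod.snd measurable_snd

/-- The law of the first `n` rounds of the game. -/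
noncomputable def law (I : Instance A B) (L : (n : ℕ) → Kernel (Fin n → Round A B) A)
    (F : FollowerAlgorithm A B) : (n : ℕ) → Measure (Fin n → Round A B)
  | 0 => Measure.dirac Fin.elim0
  | n + 1 => (law I L F n ⊗ₘ step I L F n).map
      fun q ↦ (Fin.snoc q.1 q.2 : Fin (n + 1) → Round A B)

theorem measurable_snoc {R : Type*} [MeasurableSpace R] (n : ℕ) :
    Measurable (fun q : (Fin n → R) × R ↦ (Fin.snoc q.1 q.2 : Fin (n + 1) → R)) := by
  refine measurable_pi_iff.2 fun t ↦ ?_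
  refine Fin.lastCases ?_ (fun s ↦ ?_) t
  · simpa using measurable_snd
  · simp only [Fin.snoc_castSucc]
    fun_prop

instance (I : Instance A B) (L : (n : ℕ) → Kernel (Fin n → Round A B) A)
    [∀ n, IsMarkovKernel (L n)] (F : FollowerAlgorithm A B) (n : ℕ) :
    IsMarkovKernel (step I L F n) := by
  unfold step
  infer_instance

/-- The law of the first `n` rounds is a probability measure. -/
instance isProbabilityMeasure_law (I : Instance A B) (L : (n : ℕ) → Kernel (Fin n → Round A B) A)
    [∀ n, IsMarkovKernel (L n)] (F : FollowerAlgorithm A B) (n : ℕ) :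
    IsProbabilityMeasure (law I L F n) := by
  induction n with
  | zero => unfold law; infer_instance
  | succ n ih =>
    unfold law
    exact Measure.isProbabilityMeasure_map (measurable_snoc n).aemeasurable

/-- The rewards are integrable, so the expectations in the regrets below are genuine. -/
theorem integrable_rewards (I : Instance A B) (L : (n : ℕ) → Kernel (Fin n → Round A B) A)
    [∀ n, IsMarkovKernel (L n)] (F : FollowerAlgorithm A B) (n : ℕ) (t : Fin n) :
    Integrable (fun h ↦ (h t).2) (law I L F n) := by
  induction n with
  | zero => exact t.elim0
  | succ n ih =>
    unfold law
    rw [integrable_map_measure (Measurable.aestronglyMeasurable (by fun_prop))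
      (measurable_snoc n).aemeasurable]
    revert t
    refine Fin.lastCases ?_ (fun s ↦ ?_)
    · simp only [Function.comp_def, Fin.snoc_last]
      refine ⟨Measurable.aestronglyMeasurable (by fun_prop), ?_⟩
      have hR : ∀ p : A × B, Integrable (fun r : ℝ × ℝ ↦ r) (I.reward p) := by
        intro p
        change Integrable (fun r : ℝ × ℝ ↦ r)
          ((gaussianReal (I.v₁ p.1 p.2) 1).prod (gaussianReal (I.v₂ p.1 p.2) 1))
        have h (m : ℝ) : Integrable (fun x : ℝ ↦ x) (gaussianReal m 1) := by
          exact memLp_one_iff_integrable.1 (memLp_id_gaussianReal (μ := m) (v := 1) 1)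
        exact ((h _).comp_fst _).prodMk ((h _).comp_snd _)
      have : Fintype (A × B) := Fintype.ofFinite _
      have hb : ∀ p : A × B, ∫⁻ r, ‖r‖ₑ ∂(I.reward p) ≤ ∑ p : A × B, ∫⁻ r, ‖r‖ₑ ∂(I.reward p) :=
        fun p ↦ Finset.single_le_sum (f := fun p ↦ ∫⁻ r, ‖r‖ₑ ∂(I.reward p))
          (fun _ _ ↦ zero_le) (Finset.mem_univ p)
      unfold HasFiniteIntegral
      rw [Measure.lintegral_compProd (by fun_prop)]
      refine lt_of_le_of_lt (b := ∑ p : A × B, ∫⁻ r, ‖r‖ₑ ∂(I.reward p)) ?_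
        (ENNReal.sum_lt_top.2 fun p _ ↦ (hR p).2)
      refine (lintegral_mono fun h ↦ ?_).trans
        (b := ∫⁻ _, ∑ p : A × B, ∫⁻ r, ‖r‖ₑ ∂(I.reward p) ∂(law I L F n)) (by simp)
      unfold step
      rw [Kernel.lintegral_compProd _ _ _ (by fun_prop)]
      refine (lintegral_mono fun p ↦ ?_).trans
        (b := ∫⁻ _, ∑ p : A × B, ∫⁻ r, ‖r‖ₑ ∂(I.reward p) ∂((L n ⊗ₖ F.onHistory n) h)) (by simp)
      exact hb p
    · simp only [Function.comp_def, Fin.snoc_castSucc]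
      have h1 := ih s
      rw [← Measure.fst_compProd (law I L F n) (step I L F n), Measure.fst,
        integrable_map_measure (Measurable.aestronglyMeasurable (by fun_prop)) (by fun_prop)] at h1
      exact h1

/-- The leader's regret over `T` rounds against the leader's utility at `p`. -/
noncomputable def leaderRegret (I : Instance A B) (L : (n : ℕ) → Kernel (Fin n → Round A B) A)
    (F : FollowerAlgorithm A B) (p : A × B) (T : ℕ) : ℝ :=
  I.v₁ p.1 p.2 * T - ∑ t : Fin T, ∫ h, (h t).2.1 ∂(law I L F T)

/-- The follower's regret over `T` rounds against the follower's utility at `p`. -/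
noncomputable def followerRegret (I : Instance A B) (L : (n : ℕ) → Kernel (Fin n → Round A B) A)
    (F : FollowerAlgorithm A B) (p : A × B) (T : ℕ) : ℝ :=
  I.v₂ p.1 p.2 * T - ∑ t : Fin T, ∫ h, (h t).2.2 ∂(law I L F T)

end Game

end StackelbergGame

open StackelbergGame

/-!
Fix a leader action `a₀` and a follower action `b₀`. In the *high* instance the follower prefers
`b₀` against `a₀` by a margin `δ / 2`, so the leader commits to `a₀` and is owed `1` per round, which
only `(a₀, b₀)` provides. In the *low* instance the preference is reversed by lowering the follower's
reward at the single pair `(a₀, b₀)` from `δ` to `0`. Now the leader plays another action, and the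
follower is owed `1` per round, but gets `0` whenever `(a₀, b₀)` is played. Small regret therefore
means playing `(a₀, b₀)` almost always in the high instance and almost never in the low one.

With `δ² ≈ 1 / T` the players cannot tell the instances apart. This is shown in the form
`(∫ f dQ)² ≤ C ∫ f² dP` (`SqDominated C Q P`), for the laws `Q` and `P` of the history in the high
and in the low instance. For unit-variance Gaussians the inequality holds with
`C = exp ((difference of means)²)` (`sqDominated_gaussianReal`), and it is multiplicative under
composition with kernels, so that `T` rounds cost a factor `exp (T δ²) ≤ 3` (`sqDominated_law`).
Hence the probabilities `p` and `q` of playing `(a₀, b₀)` in a given round of the two instances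
satisfy `p² ≤ 3 q`, whereas the leader's loss in the high instance is at least `(1 - p) / 2` and the
follower's in the low instance at least `q`. As `(1 - p) / 2 + p² / 3 ≥ 1 / 4`, one of the total
regrets is at least `T / 8` (`exists_instance_regret_ge`). The leader's policy may depend on the full
history here, which covers both information structures.
-/

open scoped ENNReal

namespace StackelbergGame

/-! ### Quadratic domination of measures -/

section SqDominated

variable {X Y : Type*} [MeasurableSpace X] [MeasurableSpace Y]

/-- `SqDominated C Q P` says that `(∫ f dQ)² ≤ C ∫ f² dP` for all measurable `f ≥ 0`. For
probability measures and finite `C` this amounts to `Q ≪ P` and `∫ (dQ/dP)² dP ≤ C`, but this form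
needs no densities and passes directly through composition with kernels. -/
def SqDominated (C : ℝ≥0∞) (Q P : Measure X) : Prop :=
  ∀ f : X → ℝ≥0∞, Measurable f → (∫⁻ x, f x ∂Q) ^ 2 ≤ C * ∫⁻ x, f x ^ 2 ∂P

theorem sq_lintegral_mul_le (P : Measure X) {f g : X → ℝ≥0∞} (hf : Measurable f)
    (hg : Measurable g) :
    (∫⁻ x, f x * g x ∂P) ^ 2 ≤ (∫⁻ x, f x ^ 2 ∂P) * ∫⁻ x, g x ^ 2 ∂P := by
  have h := ENNReal.lintegral_mul_le_Lp_mul_Lq P Real.HolderConjugate.two_two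
    hf.aemeasurable hg.aemeasurable
  calc (∫⁻ x, f x * g x ∂P) ^ 2
      ≤ ((∫⁻ x, f x ^ (2 : ℝ) ∂P) ^ (1 / 2 : ℝ) * (∫⁻ x, g x ^ (2 : ℝ) ∂P) ^ (1 / 2 : ℝ)) ^ 2 := by
        gcongr
        exact h
    _ = (∫⁻ x, f x ^ 2 ∂P) * ∫⁻ x, g x ^ 2 ∂P := by
        rw [mul_pow, ← ENNReal.rpow_natCast, ← ENNReal.rpow_mul, ← ENNReal.rpow_natCast,
          ← ENNReal.rpow_mul]
        simp

theorem SqDominated.refl (P : Measure X) [IsProbabilityMeasure P] : SqDominated 1 P P := by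
  intro f hf
  simpa using sq_lintegral_mul_le P hf measurable_one

theorem SqDominated.map {C : ℝ≥0∞} {Q P : Measure X} (h : SqDominated C Q P) {g : X → Y}
    (hg : Measurable g) : SqDominated C (Q.map g) (P.map g) := by
  intro f hf
  rw [lintegral_map hf hg, lintegral_map (hf.pow_const 2) hg]
  exact h _ (hf.comp hg)

theorem SqDominated.compProd {C D : ℝ≥0∞} {Q P : Measure X} [SFinite Q] [SFinite P]
    {κ η : Kernel X Y} [IsSFiniteKernel κ] [IsSFiniteKernel η] (h : SqDominated C Q P)
    (hκ : ∀ x, SqDominated D (κ x) (η x)) : SqDominated (C * D) (Q ⊗ₘ κ) (P ⊗ₘ η) := by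
  intro f hf
  rw [Measure.lintegral_compProd hf, Measure.lintegral_compProd (hf.pow_const 2)]
  calc (∫⁻ x, ∫⁻ y, f (x, y) ∂κ x ∂Q) ^ 2
      ≤ C * ∫⁻ x, (∫⁻ y, f (x, y) ∂κ x) ^ 2 ∂P := h _ hf.lintegral_kernel_prod_right'
    _ ≤ C * ∫⁻ x, D * ∫⁻ y, f (x, y) ^ 2 ∂η x ∂P := by
        gcongr with x
        exact hκ x _ (hf.comp measurable_prodMk_left)
    _ = C * D * ∫⁻ x, ∫⁻ y, f (x, y) ^ 2 ∂η x ∂P := by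
        rw [lintegral_const_mul _ (hf.pow_const 2).lintegral_kernel_prod_right', mul_assoc]

theorem SqDominated.prod {C D : ℝ≥0∞} {Q P : Measure X} {Q' P' : Measure Y} [SFinite Q]
    [SFinite P] [SFinite Q'] [SFinite P'] (h : SqDominated C Q P) (h' : SqDominated D Q' P') :
    SqDominated (C * D) (Q.prod Q') (P.prod P') := by
  rw [← Measure.compProd_const, ← Measure.compProd_const]
  exact h.compProd fun _ ↦ by simpa using h'

/-- The likelihood ratio is `ℓ x = exp ((m' - m) x - (m'² - m²) / 2)`, and `ℓ²` times the density of
`N(m, 1)` is `exp ((m' - m)²)` times the density of `N(2m' - m, 1)`. -/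
theorem sqDominated_gaussianReal (m' m : ℝ) :
    SqDominated (ENNReal.ofReal (Real.exp ((m' - m) ^ 2))) (gaussianReal m' 1)
      (gaussianReal m 1) := by
  intro f hf
  set l : ℝ → ℝ≥0∞ := fun x ↦
    ENNReal.ofReal (Real.exp ((m' - m) * x - (m' ^ 2 - m ^ 2) / 2)) with hl
  have hlm : Measurable l := by fun_prop
  have h1 : ∀ x, gaussianPDF m' 1 x = gaussianPDF m 1 x * l x := by
    intro x
    rw [gaussianPDF, gaussianPDF, hl, ← ENNReal.ofReal_mul (gaussianPDFReal_nonneg _ _ _)]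
    simp only [gaussianPDFReal]
    rw [mul_assoc (√_)⁻¹, ← Real.exp_add]
    congr 3
    push_cast
    ring
  have h2 : ∀ x, gaussianPDF m 1 x * l x ^ 2 =
      ENNReal.ofReal (Real.exp ((m' - m) ^ 2)) * gaussianPDF (2 * m' - m) 1 x := by
    intro x
    rw [gaussianPDF, gaussianPDF, hl, ← ENNReal.ofReal_pow (Real.exp_nonneg _),
      ← ENNReal.ofReal_mul (gaussianPDFReal_nonneg _ _ _),
      ← ENNReal.ofReal_mul (Real.exp_nonneg _)]
    simp only [gaussianPDFReal]
    rw [mul_assoc (√_)⁻¹, ← Real.exp_nat_mul, ← Real.exp_add, mul_left_comm, ← Real.exp_add]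
    congr 3
    push_cast
    ring
  have h3 : ∫⁻ x, f x ∂gaussianReal m' 1 = ∫⁻ x, l x * f x ∂gaussianReal m 1 := by
    rw [gaussianReal_of_var_ne_zero _ one_ne_zero, gaussianReal_of_var_ne_zero _ one_ne_zero,
      lintegral_withDensity_eq_lintegral_mul _ (by fun_prop) hf,
      lintegral_withDensity_eq_lintegral_mul _ (by fun_prop) (by fun_prop)]
    simp only [Pi.mul_apply, h1, mul_assoc]
  have h4 : ∫⁻ x, l x ^ 2 ∂gaussianReal m 1 = ENNReal.ofReal (Real.exp ((m' - m) ^ 2)) := by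
    rw [gaussianReal_of_var_ne_zero _ one_ne_zero,
      lintegral_withDensity_eq_lintegral_mul _ (by fun_prop) (by fun_prop)]
    simp only [Pi.mul_apply, h2]
    rw [lintegral_const_mul _ (by fun_prop), lintegral_gaussianPDF_eq_one _ one_ne_zero, mul_one]
  rw [h3, ← h4]
  exact sq_lintegral_mul_le _ hlm hf

end SqDominated

/-! ### Laws of the game in two instances -/

section Game

variable {A B : Type*} [MeasurableSpace A] [MeasurableSpace B] [Finite A] [Finite B]
  [DiscreteMeasurableSpace A] [DiscreteMeasurableSpace B]

/-- The next round as a measure: actions from the players' policies, then rewards from the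
instance. -/
theorem step_apply (I : Instance A B) (L : (n : ℕ) → Kernel (Fin n → Round A B) A)
    [∀ n, IsMarkovKernel (L n)] (F : FollowerAlgorithm A B) (n : ℕ) (h : Fin n → Round A B) :
    step I L F n h = (L n ⊗ₖ F.onHistory n) h ⊗ₘ I.reward :=
  Kernel.compProd_apply_eq_compProd_sectR _ _ _

/-- A pointwise comparison of the reward distributions gives one of the whole histories. The
players' own randomization costs nothing, because it is the same in both instances. -/
theorem sqDominated_law {C : ℝ≥0∞} {I J : Instance A B}
    (h : ∀ p, SqDominated C (I.reward p) (J.reward p))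
    (L : (n : ℕ) → Kernel (Fin n → Round A B) A) [∀ n, IsMarkovKernel (L n)]
    (F : FollowerAlgorithm A B) (n : ℕ) : SqDominated (C ^ n) (law I L F n) (law J L F n) := by
  induction n with
  | zero => simpa [law] using SqDominated.refl (Measure.dirac Fin.elim0)
  | succ n ih =>
    rw [law, law, pow_succ]
    refine (ih.compProd fun x ↦ ?_).map (measurable_snoc n)
    rw [step_apply, step_apply, ← one_mul C]
    exact (SqDominated.refl ((L n ⊗ₖ F.onHistory n) x)).compProd fun p ↦ h p

theorem integrable_comp_of_finite {Ω Z : Type*} [MeasurableSpace Ω] [MeasurableSpace Z] [Finite Z]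
    [DiscreteMeasurableSpace Z] (μ : Measure Ω) [IsFiniteMeasure μ] (v : Z → ℝ) {f : Ω → Z}
    (hf : Measurable f) : Integrable (fun ω ↦ v (f ω)) μ :=
  (Integrable.of_finite (μ := μ.map f) (f := v)).comp_measurable hf

/-- The expected reward of a round is the expected mean reward of the actions played in it. Here `g`
stands for the projection to either player's reward, and `v` for its mean. -/
theorem integral_reward_eq (I : Instance A B) (L : (n : ℕ) → Kernel (Fin n → Round A B) A)
    [∀ n, IsMarkovKernel (L n)] (F : FollowerAlgorithm A B) {g : ℝ × ℝ →L[ℝ] ℝ} {v : A × B → ℝ}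
    (hv : ∀ p, ∫ r, g r ∂(I.reward p) = v p) (n : ℕ) (t : Fin n) :
    ∫ h, g (h t).2 ∂(law I L F n) = ∫ h, v (h t).1 ∂(law I L F n) := by
  have hvm : Measurable v := by fun_prop
  induction n with
  | zero => exact t.elim0
  | succ n ih =>
    have hint := fun t ↦ g.integrable_comp (integrable_rewards I L F (n + 1) t)
    unfold law at hint ⊢
    rw [integral_map (measurable_snoc n).aemeasurable
        (Measurable.aestronglyMeasurable (by fun_prop)),
      integral_map (measurable_snoc n).aemeasurable
        (Measurable.aestronglyMeasurable (by fun_prop))]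
    replace hint := fun t ↦ (integrable_map_measure (Measurable.aestronglyMeasurable (by fun_prop))
      (measurable_snoc n).aemeasurable).1 (hint t)
    revert t
    refine Fin.lastCases ?_ (fun s ↦ ?_)
    · specialize hint (Fin.last n)
      simp only [Function.comp_def, Fin.snoc_last] at hint ⊢
      rw [Measure.integral_compProd hint, Measure.integral_compProd
        (integrable_comp_of_finite _ v (by fun_prop))]
      have hae := ((Measure.integrable_compProd_iff hint.1).1 hint).1
      refine integral_congr_ae ?_
      filter_upwards [hae] with h hh
      rw [step_apply] at hh ⊢
      have h1 := integrable_comp_of_finite ((L n ⊗ₖ F.onHistory n) h ⊗ₘ I.reward) v measurable_fst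
      rw [Measure.integral_compProd hh, Measure.integral_compProd h1]
      refine integral_congr_ae (.of_forall fun p ↦ ?_)
      simpa using hv p
    · simp only [Fin.snoc_castSucc]
      have h1 := ih s
      rw [← Measure.fst_compProd (law I L F n) (step I L F n), Measure.fst,
        integral_map (by fun_prop) (Measurable.aestronglyMeasurable (by fun_prop)),
        integral_map (by fun_prop) (Measurable.aestronglyMeasurable (by fun_prop))] at h1
      exact h1

theorem integral_leader_reward (I : Instance A B) (L : (n : ℕ) → Kernel (Fin n → Round A B) A)
    [∀ n, IsMarkovKernel (L n)] (F : FollowerAlgorithm A B) (n : ℕ) (t : Fin n) :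
    ∫ h, (h t).2.1 ∂(law I L F n) = ∫ h, I.v₁ (h t).1.1 (h t).1.2 ∂(law I L F n) :=
  integral_reward_eq I L F (g := .fst ℝ ℝ ℝ) (v := fun p ↦ I.v₁ p.1 p.2) (fun p ↦ by
    change ∫ r, r.1 ∂((gaussianReal (I.v₁ p.1 p.2) 1).prod (gaussianReal (I.v₂ p.1 p.2) 1)) = _
    rw [integral_fun_fst (fun x : ℝ ↦ x)]
    simp [integral_id_gaussianReal]) n t

theorem integral_follower_reward (I : Instance A B) (L : (n : ℕ) → Kernel (Fin n → Round A B) A)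
    [∀ n, IsMarkovKernel (L n)] (F : FollowerAlgorithm A B) (n : ℕ) (t : Fin n) :
    ∫ h, (h t).2.2 ∂(law I L F n) = ∫ h, I.v₂ (h t).1.1 (h t).1.2 ∂(law I L F n) :=
  integral_reward_eq I L F (g := .snd ℝ ℝ ℝ) (v := fun p ↦ I.v₂ p.1 p.2) (fun p ↦ by
    change ∫ r, r.2 ∂((gaussianReal (I.v₁ p.1 p.2) 1).prod (gaussianReal (I.v₂ p.1 p.2) 1)) = _
    rw [integral_fun_snd (fun x : ℝ ↦ x)]
    simp [integral_id_gaussianReal]) n t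

end Game

/-! ### The hard instances -/

section HardInstance

variable {A B : Type*}

open Classical in
/-- Against `a₀` the follower chooses between `b₀`, worth `θ` to the follower and `1` to the leader,
and the other actions, worth `δ / 2` to the follower and `0` to the leader. Any other leader action
gives the leader `1 / 2`, and the follower `1` with `b₀` and `0` otherwise. Only `θ = δ` and `θ = 0`
are used: they lie on the two sides of `δ / 2`. -/
noncomputable def hardInstance (a₀ : A) (b₀ : B) {δ θ : ℝ} (hδ : δ ∈ Set.Icc (0 : ℝ) 1)
    (hθ : θ ∈ Set.Icc (0 : ℝ) 1) : Instance A B where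
  v₁ a b := if a = a₀ then if b = b₀ then 1 else 0 else 1 / 2
  v₂ a b := if a = a₀ then if b = b₀ then θ else δ / 2 else if b = b₀ then 1 else 0
  v₁_mem a b := by split_ifs <;> norm_num
  v₂_mem a b := by
    obtain ⟨h0, h1⟩ := hδ
    split_ifs
    · exact hθ
    · exact ⟨by linarith, by linarith⟩
    · norm_num
    · norm_num

variable {a₀ : A} {b₀ : B} {δ θ : ℝ} (hδ : δ ∈ Set.Icc (0 : ℝ) 1) (hθ : θ ∈ Set.Icc (0 : ℝ) 1)

theorem isBestResponse_hardInstance_of_ne {a : A} (ha : a ≠ a₀) {b : B} :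
    (hardInstance a₀ b₀ hδ hθ).IsBestResponse a b ↔ b = b₀ := by
  constructor
  · rintro ⟨h, -⟩
    by_contra hb
    have := h b₀
    simp only [hardInstance, ha, hb, if_true, if_false] at this
    linarith
  · rintro rfl
    refine ⟨fun b' ↦ ?_, fun b' _ ↦ ?_⟩
    · simp only [hardInstance, ha, if_true, if_false]
      split_ifs <;> norm_num
    · simp [hardInstance, ha]

theorem isBestResponse_hardInstance_high (hpos : 0 < δ) {b : B} :
    (hardInstance a₀ b₀ hδ hδ).IsBestResponse a₀ b ↔ b = b₀ := by
  constructor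
  · rintro ⟨h, -⟩
    by_contra hb
    have := h b₀
    simp only [hardInstance, hb, if_true, if_false] at this
    linarith
  · rintro rfl
    refine ⟨fun b' ↦ ?_, fun b' hb' ↦ ?_⟩
    · simp only [hardInstance, if_true]
      split_ifs <;> linarith
    · by_contra hlt
      by_cases h : b' = b
      · exact hlt (by rw [h])
      · simp only [hardInstance, h, if_true, if_false] at hb'
        linarith

theorem ne_of_isBestResponse_hardInstance_low [Nontrivial B] (hpos : 0 < δ)
    {b : B} (h : (hardInstance a₀ b₀ hδ (θ := 0) (by simp)).IsBestResponse a₀ b) : b ≠ b₀ := by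
  rintro rfl
  obtain ⟨b', hb'⟩ := exists_ne b
  have := h.1 b'
  simp only [hardInstance, hb', if_true, if_false] at this
  linarith

theorem isStackelbergEquilibrium_hardInstance_high (hpos : 0 < δ) :
    (hardInstance a₀ b₀ hδ hδ).IsStackelbergEquilibrium (a₀, b₀) := by
  refine ⟨(isBestResponse_hardInstance_high hδ hpos).2 rfl, fun a b _ ↦ ?_⟩
  simpa [hardInstance] using (hardInstance a₀ b₀ hδ hδ).v₁_mem a b |>.2

theorem isStackelbergEquilibrium_hardInstance_low [Nontrivial B] (hpos : 0 < δ) {a : A}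
    (ha : a ≠ a₀) :
    (hardInstance a₀ b₀ hδ (θ := 0) (by simp)).IsStackelbergEquilibrium (a, b₀) := by
  refine ⟨(isBestResponse_hardInstance_of_ne _ _ ha).2 rfl, fun a' b h ↦ ?_⟩
  by_cases ha' : a' = a₀
  · subst ha'
    have hb := ne_of_isBestResponse_hardInstance_low hδ hpos h
    simp [hardInstance, hb, ha]
  · simp [hardInstance, ha, ha']

theorem leader_benchmark_hardInstance_high (hpos : 0 < δ) {p : A × B}
    (hp : (hardInstance a₀ b₀ hδ hδ).IsStackelbergEquilibrium p) :
    (hardInstance a₀ b₀ hδ hδ).v₁ p.1 p.2 = 1 := by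
  refine le_antisymm (Instance.v₁_mem _ _ _).2 ?_
  simpa [hardInstance] using hp.2 a₀ b₀ ((isBestResponse_hardInstance_high hδ hpos).2 rfl)

theorem follower_benchmark_hardInstance_low [Nontrivial A] [Nontrivial B] (hpos : 0 < δ)
    {p : A × B}
    (hp : (hardInstance a₀ b₀ hδ (θ := 0) (by simp)).IsStackelbergEquilibrium p) :
    (hardInstance a₀ b₀ hδ (θ := 0) (by simp)).v₂ p.1 p.2 = 1 := by
  obtain ⟨a, b⟩ := p
  obtain ⟨hbr, hmax⟩ := hp
  by_cases ha : a = a₀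
  · subst ha
    obtain ⟨a', ha'⟩ := exists_ne a
    have hb := ne_of_isBestResponse_hardInstance_low hδ hpos hbr
    have := hmax a' b₀ ((isBestResponse_hardInstance_of_ne _ _ ha').2 rfl)
    simp only [hardInstance, ha', hb, if_true, if_false] at this
    norm_num at this
  · obtain rfl := (isBestResponse_hardInstance_of_ne _ _ ha).1 hbr
    simp [hardInstance, ha]

theorem sqDominated_reward_hardInstance [MeasurableSpace A] [MeasurableSpace B] [Finite A]
    [Finite B] [DiscreteMeasurableSpace A] [DiscreteMeasurableSpace B] (p : A × B) :
    SqDominated (ENNReal.ofReal (Real.exp (δ ^ 2))) ((hardInstance a₀ b₀ hδ hδ).reward p)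
      ((hardInstance a₀ b₀ hδ (θ := 0) (by simp)).reward p) := by
  set I := hardInstance a₀ b₀ hδ hδ
  set J := hardInstance a₀ b₀ hδ (θ := 0) (by simp)
  rw [← one_mul (ENNReal.ofReal _)]
  change SqDominated _ ((gaussianReal (I.v₁ p.1 p.2) 1).prod (gaussianReal (I.v₂ p.1 p.2) 1))
    ((gaussianReal (I.v₁ p.1 p.2) 1).prod (gaussianReal (J.v₂ p.1 p.2) 1))
  have hsq : (I.v₂ p.1 p.2 - J.v₂ p.1 p.2) ^ 2 ≤ δ ^ 2 := by
    refine sq_le_sq' ?_ ?_ <;>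
    · simp only [I, J, hardInstance]
      split_ifs <;> linarith [hδ.1]
  refine (SqDominated.refl _).prod fun f hf ↦
    (sqDominated_gaussianReal _ (J.v₂ p.1 p.2) f hf).trans ?_
  exact mul_le_mul_left (ENNReal.ofReal_le_ofReal (Real.exp_le_exp.2 hsq)) _

end HardInstance

/-! ### Regret in the hard instances -/

section Regret

variable {A B : Type*} [MeasurableSpace A] [MeasurableSpace B] [Finite A] [Finite B]
  [DiscreteMeasurableSpace A] [DiscreteMeasurableSpace B]
  (L : (n : ℕ) → Kernel (Fin n → Round A B) A) [∀ n, IsMarkovKernel (L n)]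
  (F : FollowerAlgorithm A B) {a₀ : A} {b₀ : B} {δ : ℝ} (hδ : δ ∈ Set.Icc (0 : ℝ) 1) {T : ℕ}

/-- The probability that `p` is played in round `t` of the `T`-round game. -/
noncomputable def playProb (I : Instance A B) (p : A × B) (t : Fin T) : ℝ :=
  (law I L F T).real {h | (h t).1 = p}

theorem integral_play_le (I : Instance A B) {u : A × B → ℝ} {p : A × B} {x y : ℝ}
    (hx : ∀ q, q ≠ p → u q ≤ x) (hy : u p ≤ y) (t : Fin T) :
    ∫ h, u (h t).1 ∂(law I L F T) ≤ x + (y - x) * playProb L F I p t := by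
  have hS : MeasurableSet {h : Fin T → Round A B | (h t).1 = p} :=
    measurableSet_eq_fun (by fun_prop) measurable_const
  have hint := ((integrable_const (μ := law I L F T) (1 : ℝ)).indicator hS).const_mul (y - x)
  calc ∫ h, u (h t).1 ∂(law I L F T)
      ≤ ∫ h, (x + (y - x) * {h : Fin T → Round A B | (h t).1 = p}.indicator (fun _ ↦ 1) h)
          ∂(law I L F T) := by
        refine integral_mono (integrable_comp_of_finite _ u (by fun_prop))
          ((integrable_const _).add hint) fun h ↦ ?_
        by_cases hh : (h t).1 = p
        · simpa [hh] using hy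
        · simpa [hh] using hx _ hh
    _ = x + (y - x) * playProb L F I p t := by
        rw [integral_add (integrable_const _) hint, integral_const_mul, integral_indicator hS]
        simp [playProb]

theorem leaderRegret_hardInstance_high_ge (hpos : 0 < δ) {p : A × B}
    (hp : (hardInstance a₀ b₀ hδ hδ).IsStackelbergEquilibrium p) :
    ∑ t : Fin T, (1 - playProb L F (hardInstance a₀ b₀ hδ hδ) (a₀, b₀) t) / 2 ≤
      leaderRegret (hardInstance a₀ b₀ hδ hδ) L F p T := by
  rw [leaderRegret, leader_benchmark_hardInstance_high hδ hpos hp]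
  have hT : (1 : ℝ) * T = ∑ t : Fin T, (1 : ℝ) := by simp
  rw [hT, ← Finset.sum_sub_distrib]
  gcongr with t
  rw [integral_leader_reward]
  have := integral_play_le L F (hardInstance a₀ b₀ hδ hδ) (p := (a₀, b₀)) (x := 1 / 2)
    (u := fun q ↦ (hardInstance a₀ b₀ hδ hδ).v₁ q.1 q.2) ?_ (Instance.v₁_mem _ _ _).2 t
  · linarith
  · rintro ⟨a, b⟩ hq
    by_cases ha : a = a₀
    · have hb : b ≠ b₀ := fun hb ↦ hq (by rw [ha, hb])
      simp [hardInstance, ha, hb]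
    · simp [hardInstance, ha]

theorem followerRegret_hardInstance_low_ge [Nontrivial A] [Nontrivial B] (hpos : 0 < δ)
    {p : A × B}
    (hp : (hardInstance a₀ b₀ hδ (θ := 0) (by simp)).IsStackelbergEquilibrium p) :
    ∑ t : Fin T, playProb L F (hardInstance a₀ b₀ hδ (θ := 0) (by simp)) (a₀, b₀) t ≤
      followerRegret (hardInstance a₀ b₀ hδ (θ := 0) (by simp)) L F p T := by
  rw [followerRegret, follower_benchmark_hardInstance_low hδ hpos hp]
  have hT : (1 : ℝ) * T = ∑ t : Fin T, (1 : ℝ) := by simp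
  rw [hT, ← Finset.sum_sub_distrib]
  gcongr with t
  rw [integral_follower_reward]
  have := integral_play_le L F (hardInstance a₀ b₀ hδ (θ := 0) (by simp)) (p := (a₀, b₀))
    (y := 0) (u := fun q ↦ (hardInstance a₀ b₀ hδ (θ := 0) (by simp)).v₂ q.1 q.2)
    (fun q _ ↦ (Instance.v₂_mem _ _ _).2) (by simp [hardInstance]) t
  linarith

/-- `SqDominated` applied to the indicator of an event `S`: `Q(S)² ≤ C P(S)`. -/
theorem sq_playProb_le {C : ℝ≥0∞} {c : ℝ} (hc : 0 ≤ c) (hCc : C ≤ ENNReal.ofReal c)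
    {I J : Instance A B} (h : SqDominated C (law I L F T) (law J L F T)) (p : A × B)
    (t : Fin T) : playProb L F I p t ^ 2 ≤ c * playProb L F J p t := by
  have hS : MeasurableSet {h : Fin T → Round A B | (h t).1 = p} :=
    measurableSet_eq_fun (by fun_prop) measurable_const
  have h1 := h _ (measurable_one.indicator hS)
  have h2 (x) :
      {h : Fin T → Round A B | (h t).1 = p}.indicator (1 : (Fin T → Round A B) → ℝ≥0∞) x ^ 2 =
        {h | (h t).1 = p}.indicator 1 x := by
    by_cases hx : x ∈ {h : Fin T → Round A B | (h t).1 = p} <;> simp [hx]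
  simp only [h2, lintegral_indicator_one hS] at h1
  have h3 := ENNReal.toReal_mono (by finiteness) (h1.trans (mul_le_mul_left hCc _))
  simpa [playProb, Measure.real, ENNReal.toReal_ofReal hc] using h3

/-- The linear lower bound holds for every leader, even one who sees the full history, so the
information structure of the game does not matter. -/
theorem exists_instance_regret_ge [Nontrivial A] [Nontrivial B] (T : ℕ) :
    ∃ I : Instance A B, (∃ p, I.IsStackelbergEquilibrium p) ∧
      ∀ p, I.IsStackelbergEquilibrium p →
        1 / 8 * T ≤ max (leaderRegret I L F p T) (followerRegret I L F p T) := by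
  obtain ⟨a₀, a₁, ha⟩ := exists_pair_ne A
  obtain ⟨b₀⟩ : Nonempty B := inferInstance
  -- Then `T δ² ≤ 1`; the summand `1` keeps `δ` positive at `T = 0`.
  set δ : ℝ := 1 / √(T + 1) with hδdef
  have hpos : 0 < δ := by positivity
  have hδ : δ ∈ Set.Icc (0 : ℝ) 1 := by
    refine ⟨hpos.le, ?_⟩
    rw [hδdef, div_le_one (by positivity)]
    exact Real.one_le_sqrt.2 (by simp)
  set I := hardInstance a₀ b₀ hδ hδ
  set J := hardInstance a₀ b₀ hδ (θ := 0) (by simp)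
  have hC : ENNReal.ofReal (Real.exp (δ ^ 2)) ^ T ≤ ENNReal.ofReal 3 := by
    rw [← ENNReal.ofReal_pow (Real.exp_nonneg _), ← Real.exp_nat_mul]
    refine ENNReal.ofReal_le_ofReal ((Real.exp_le_exp.2 (?_ : _ ≤ (1 : ℝ))).trans
      Real.exp_one_lt_three.le)
    rw [hδdef, div_pow, Real.sq_sqrt (by positivity), one_pow, mul_one_div]
    exact (div_le_one (by positivity)).2 (by simp)
  have hPQ (t : Fin T) := sq_playProb_le L F (by norm_num) hC
    (sqDominated_law (I := I) (J := J) (sqDominated_reward_hardInstance hδ) L F T) (a₀, b₀) t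
  have hsum : (1 / 4 : ℝ) * T ≤ ∑ t : Fin T, (1 - playProb L F I (a₀, b₀) t) / 2 +
      ∑ t : Fin T, playProb L F J (a₀, b₀) t := by
    rw [← Finset.sum_add_distrib]
    have hT : (1 / 4 : ℝ) * T = ∑ t : Fin T, (1 / 4 : ℝ) := by simp [mul_comm]
    rw [hT]
    gcongr with t
    -- `(1 - p) / 2 + p² / 3` is smallest at `p = 3 / 4`, where it is `5 / 16`.
    nlinarith [hPQ t, sq_nonneg (playProb L F I (a₀, b₀) t - 3 / 4)]
  by_cases h : (1 / 8 : ℝ) * T ≤ ∑ t : Fin T, (1 - playProb L F I (a₀, b₀) t) / 2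
  · exact ⟨I, ⟨_, isStackelbergEquilibrium_hardInstance_high hδ hpos⟩, fun p hp ↦
      le_max_of_le_left (h.trans (leaderRegret_hardInstance_high_ge L F hδ hpos hp))⟩
  · refine ⟨J, ⟨_, isStackelbergEquilibrium_hardInstance_low hδ hpos ha.symm⟩, fun p hp ↦
      le_max_of_le_right (le_trans ?_ (followerRegret_hardInstance_low_ge L F hδ hpos hp))⟩
    linarith

end Regret

end StackelbergGame

theorem theorem1 :
    ∃ c : ℝ, 0 < c ∧
      ∀ (A B : Type*) [Fintype A] [Fintype B] [MeasurableSpace A] [MeasurableSpace B]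
        [DiscreteMeasurableSpace A] [DiscreteMeasurableSpace B],
        Fintype.card A = 2 → Fintype.card B = 2 →
        ∀ (T : ℕ) (ALG₂ : FollowerAlgorithm A B),
          -- strongly decentralized games
          (∀ ALG₁ : StrongLeaderAlgorithm A, ∃ I : Instance A B,
            (∃ p, I.IsStackelbergEquilibrium p) ∧
            ∀ p, I.IsStackelbergEquilibrium p →
              c * T ≤ max (leaderRegret I (ALG₁.onHistory B) ALG₂ p T)
                (followerRegret I (ALG₁.onHistory B) ALG₂ p T)) ∧
          -- weakly decentralized games
          (∀ ALG₁ : WeakLeaderAlgorithm A B, ∃ I : Instance A B,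
            (∃ p, I.IsStackelbergEquilibrium p) ∧
            ∀ p, I.IsStackelbergEquilibrium p →
              c * T ≤ max (leaderRegret I ALG₁.onHistory ALG₂ p T)
                (followerRegret I ALG₁.onHistory ALG₂ p T)) := by
  refine ⟨1 / 8, by norm_num, fun A B _ _ _ _ _ _ hA hB T ALG₂ ↦ ?_⟩
  have : Nontrivial A := Fintype.one_lt_card_iff_nontrivial.1 (by omega)
  have : Nontrivial B := Fintype.one_lt_card_iff_nontrivial.1 (by omega)
  exact ⟨fun ALG₁ ↦ exists_instance_regret_ge _ ALG₂ T,
    fun ALG₁ ↦ exists_instance_regret_ge _ ALG₂ T⟩
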